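/- **Types and functionals.** The types of finite rank are generated from the type $0$ by $(\sigma_1,\dots,\sigma_n\to 0)$, $n\ge 1$, also written in curried form $\sigma_1\to(\sigma_2,\dots,\sigma_n\to 0)$. The rank is $\mathbf r(0)=0$, $\mathbf r(\sigma_1,\dots,\sigma_n\to0)=\max_i(\mathbf r(\sigma_i)+1)$, and $\mathbf{Ty}(k)$ is the set of types of rank $\le k$. Put $\mathbb N_\bot=\mathbb N\cup\{\bot\}$, $\mathbf F(0)=\mathbb N$, $\mathbf P(0)=\mathbb N_\bot$; for $\sigma=(\sigma_1,\dots,\sigma_n\to0)$ let $\mathbf F(\sigma)$ be the set of all maps $\mathbf F(\sigma_1)\times\cdots\times\mathbf F(\sigma_n)\to\mathbb N$ and $\mathbf P(\sigma)\supseteq\mathbf F(\sigma)$ the set of all maps $\mathbf F(\sigma_1)\times\cdots\times\mathbf F(\sigma_n)\to\mathbb N_\bot$, ordered by extension. **Terms.** The typed terms are: $\hat 0$ of type $0$; $\mathsf{suc}$ and $\mathsf{pred}$ of type $0\to0$; $\mathsf{case}\,t_1t_2t_3$ of type $0$ for terms $t_1,t_2,t_3$ of type $0$ (so $\mathsf{case}$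 occurs only together with its three arguments); variables $x_i^\sigma$ $(i\in\mathbb N)$ of type $\sigma$ and a secondary constant $\hat\phi$ of type $\sigma$ for each $\phi\in\mathbf P(\sigma)$, where $\sigma\in\mathbf{Ty}(3)$; applications $(ts)$ of type $\tau$ for $t$ of type $\sigma\to\tau$ and $s$ of type $\sigma$; abstractions $(\lambda x_i^\sigma t)$ of type $\sigma\to\tau$ for $t$ of type $\tau$, if $\mathbf r(\sigma\to\tau)\le3$; and $(\mu x_i^\sigma t)$ of type $\sigma$ for $t$ of type $\sigma$, if $\mathbf r(\sigma)\le3$. A term is closed if it has no free variables. **Interpretation.** Under an assignment of elements of $\mathbf P(\sigma)$ to the variables of type $\sigma$, each term $t$ of type $\tau$ has an interpretation $[[t]]\in\mathbf P(\tau)$. Here $\hat0$, $\mathsf{suc}$, $\mathsf{pred}$ are $0$, successor and predecessor (with $\mathsf{pred}(0)=0$); $[[\hat\phi]]=\phi$; a variable is interpreted by its assigned value; $[[\mathsf{case}\,t_1t_2t_3]]$ is $[[t_2]]$ if $[[t_1]]=0$, is $[[t_3]]$ if $[[t_1]]\in\mathbb N$ is positive, and is $\bot$ if $[[t_1]]=\bot$;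 $[[ts]]=[[t]]([[s]])$ if $[[s]]$ is total, and $[[ts]]$ is everywhere undefined otherwise; $[[\lambda x\,t]]$ sends a total $\phi$ to the interpretation of $t$ with $x$ assigned $\phi$; and $[[\mu x\,t]]$ is the least fixed point of the monotone map sending $\psi$ to the interpretation of $t$ with $x$ assigned $\psi$. For closed $t$ this does not depend on the assignment. **Computation trees.** For a closed term $t$ of type $0$, the computation tree $T[t]$ is a set of finite sequences of terms. It contains the empty sequence and the one-term sequence $t$, and it contains $t$ followed by any sequence of one of its immediate subtrees. The immediate subtrees, and the value of $T[t]$ (the values being assigned inductively, bottom-up), are as follows. - $t=\hat0$: there is no subtree and the value is $0$. More generally, $t=\hat k$ for a secondary constant with $k\in\mathbb N$ has no subtree and has value $k$, and $t=\hat\bot$ has no subtree and no value. - $t=\mathsf{suc}\,t_1$ or $t=\mathsf{pred}\,t_1$: the subtree is $T[t_1]$. If it has value $a$, then $T[t]$ has value $a+1$, respectively $\mathsf{pred}(a)$. - $t=\mathsf{case}\,t_1t_2t_3$: $T[t_1]$ is a subtree. If $T[t_1]$ has a value $a$, then $T[t_2]$ (if $a=0$) or $T[t_3]$ (if $a>0$)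 is also a subtree, and its value, if any, is the value of $T[t]$. - $t=\hat\Phi\,t_2\cdots t_n$ with $n\ge2$ and $\hat\Phi$ a secondary constant, where $t_2$ has type $(\delta_1,\dots,\delta_m\to0)$: the trees $T[t_2\hat\phi_1\cdots\hat\phi_m]$ for all $(\phi_1,\dots,\phi_m)\in\mathbf F(\delta_1)\times\cdots\times\mathbf F(\delta_m)$ are subtrees. If all of them have values, these define a total functional $\Psi_2$; with $\xi=\Phi(\Psi_2)$, the tree $T[\hat\xi\,t_3\cdots t_n]$ is then also a subtree, and its value, if any, is the value of $T[t]$. (For $t_2$ of type $0$ we have $m=0$.) - $t=(\lambda x\,t_1)t_2\cdots t_n$ with $n\ge2$: as in the previous item with $t_2$, but with $T[t_1[x/t_2]\,t_3\cdots t_n]$ in place of $T[\hat\xi\,t_3\cdots t_n]$. - $t=(\mu x\,t_1)t_2\cdots t_n$ with $n\ge1$: the subtree is $T[t_1[x/(\mu x\,t_1)]\,t_2\cdots t_n]$, and its value, if any, is the value of $T[t]$. A tree is well-founded if it has no infinite branch. **Theorem.** Let $t$ be a closed term of type $0$ and let $n\in\mathbb N$. The following are equivalent: 1. the interpretation of $t$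 satisfies $[[t]]=n$; 2. the tree $T[t]$ is well-founded and has value $n$. -/

import Mathlib

namespace PartialLambda

/-! ### Types, total functionals and partial functionals -/

/-- The types of finite rank: `0` and, in curried form, `(σ₁, …, σₙ → 0) = σ₁ → (… → (σₙ → 0))`. -/
inductive Ty : Type
  | zero : Ty
  | arrow (σ τ : Ty) : Ty
  deriving DecidableEq

/-- `r(0) = 0` and `r(σ₁, …, σₙ → 0) = max (r(σᵢ) + 1)`. -/
def Ty.rank : Ty → ℕ
  | .zero => 0
  | .arrow σ τ => max (σ.rank + 1) τ.rank

theorem Ty.rank_dom {σ τ : Ty} (h : (Ty.arrow σ τ).rank ≤ 3) : σ.rank ≤ 3 := by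
  simp only [Ty.rank] at h
  omega

theorem Ty.rank_cod {σ τ : Ty} (h : (Ty.arrow σ τ).rank ≤ 3) : τ.rank ≤ 3 := by
  simp only [Ty.rank] at h
  omega

/-- `F σ`: the total functionals of type `σ`, all of whose arguments are total. -/
def F : Ty → Type
  | .zero => ℕ
  | .arrow σ τ => F σ → F τ

/-- `P σ`: the partial functionals of type `σ`; the arguments are total, the values lie in
`Part ℕ = ℕ ∪ {⊥}`. -/
def P : Ty → Type
  | .zero => Part ℕ
  | .arrow σ τ => F σ → P τ

/-- The inclusion of `F σ` in `P σ`. -/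
def F.toP : {σ : Ty} → F σ → P σ
  | .zero, k => Part.some k
  | .arrow _ _, f => fun ξ => (f ξ).toP

/-- The product `F δ₁ × ⋯ × F δₘ` of the argument types of `σ = (δ₁, …, δₘ → 0)`. -/
def Inputs : Ty → Type
  | .zero => Unit
  | .arrow σ τ => F σ × Inputs τ

/-- The value `f(ξ₁, …, ξₘ)` of a total functional. -/
def F.eval : {σ : Ty} → F σ → Inputs σ → ℕ
  | .zero, k, _ => k
  | .arrow _ _, f, ξs => (f ξs.1).eval ξs.2

/-- The extension order on `P σ`: pointwise, with the flat order on `ℕ ∪ {⊥}`. -/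
instance P.instPartialOrder : (σ : Ty) → PartialOrder (P σ)
  | .zero => inferInstanceAs (PartialOrder (Part ℕ))
  | .arrow σ τ =>
    letI := P.instPartialOrder τ
    inferInstanceAs (PartialOrder (F σ → P τ))

/-- The everywhere undefined functional. -/
def P.undef : (σ : Ty) → P σ
  | .zero => (Part.none : Part ℕ)
  | .arrow _ τ => fun _ => P.undef τ

/-- Application of partial functionals, everywhere undefined unless the argument is total. -/
noncomputable def P.app {σ τ : Ty} (u : P (.arrow σ τ)) (v : P σ) : P τ :=
  open Classical in
  if h : ∃ ξ : F σ, ξ.toP = v then u h.choose else P.undef τ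

/-- `case (z, x, y)` is `x` if `z = 0` and `y` if `z > 0`; it is undefined if `z` is undefined, but
only the selected one of `x` and `y` needs to be defined. -/
def P.case (z x y : Part ℕ) : Part ℕ :=
  z.bind fun k => if k = 0 then x else y

/-- The least fixed point of `f`; for monotone `f` it exists, see `P.isLeast_lfp`. -/
noncomputable def P.lfp {σ : Ty} (f : P σ → P σ) : P σ :=
  open Classical in
  if h : ∃ ψ : P σ, IsLeast {ψ | f ψ = ψ} ψ then h.choose else P.undef σ

/-! ### Terms -/

/-- The typed terms of the language. `var i` at type `σ` is the variable `x_i^σ`, and `const φ` is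
the secondary constant for the partial functional `φ`. Since `case` inspects only one of its last
two arguments, it is a term former: it occurs together with its three arguments. -/
inductive Term : Ty → Type
  | zero : Term .zero
  | suc : Term (.arrow .zero .zero)
  | pred : Term (.arrow .zero .zero)
  | case (t₁ t₂ t₃ : Term .zero) : Term .zero
  | var {σ : Ty} (h : σ.rank ≤ 3) (i : ℕ) : Term σ
  | const {σ : Ty} (h : σ.rank ≤ 3) (φ : P σ) : Term σ
  | app {σ τ : Ty} (t : Term (.arrow σ τ)) (s : Term σ) : Term τ
  | lam {σ τ : Ty} (h : (Ty.arrow σ τ).rank ≤ 3) (i : ℕ) (t : Term τ) : Term (.arrow σ τ)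
  | mu {σ : Ty} (h : σ.rank ≤ 3) (i : ℕ) (t : Term σ) : Term σ

theorem Term.rank_le {σ : Ty} (t : Term σ) : σ.rank ≤ 3 := by
  induction t with
  | zero => simp [Ty.rank]
  | suc => simp [Ty.rank]
  | pred => simp [Ty.rank]
  | case => simp [Ty.rank]
  | var h => exact h
  | const h => exact h
  | app _ _ ih _ => exact Ty.rank_cod ih
  | lam h => exact h
  | mu h => exact h

/-- `t.FreeIn σ i`: the variable `x_i^σ` occurs free in `t`. -/
def Term.FreeIn (σ : Ty) (i : ℕ) : {τ : Ty} → Term τ → Prop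
  | _, .zero => False
  | _, .suc => False
  | _, .pred => False
  | _, .case t₁ t₂ t₃ => t₁.FreeIn σ i ∨ t₂.FreeIn σ i ∨ t₃.FreeIn σ i
  | _, .var (σ := σ') _ j => σ' = σ ∧ j = i
  | _, .const _ _ => False
  | _, .app t s => t.FreeIn σ i ∨ s.FreeIn σ i
  | _, .lam (σ := σ') _ j t => ¬ (σ' = σ ∧ j = i) ∧ t.FreeIn σ i
  | _, .mu (σ := σ') _ j t => ¬ (σ' = σ ∧ j = i) ∧ t.FreeIn σ i

/-- A closed term has no free variables. -/
def Term.Closed {τ : Ty} (t : Term τ) : Prop :=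
  ∀ (σ : Ty) (i : ℕ), ¬ t.FreeIn σ i

/-- `t.subst i s = t[x_i^σ / s]`: all free occurrences of `x_i^σ` in `t` are replaced by `s`. It is
only used with closed `s`, so no variable is captured. -/
def Term.subst : {τ : Ty} → Term τ → {σ : Ty} → ℕ → Term σ → Term τ
  | _, .zero, _, _, _ => .zero
  | _, .suc, _, _, _ => .suc
  | _, .pred, _, _, _ => .pred
  | _, .case t₁ t₂ t₃, _, i, s => .case (t₁.subst i s) (t₂.subst i s) (t₃.subst i s)
  | _, .var (σ := σ') h j, σ, i, s => if e : σ = σ' ∧ j = i then e.1 ▸ s else .var h j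
  | _, .const h φ, _, _, _ => .const h φ
  | _, .app t u, _, i, s => .app (t.subst i s) (u.subst i s)
  | _, .lam (σ := σ') h j t, σ, i, s => .lam h j (if σ = σ' ∧ j = i then t else t.subst i s)
  | _, .mu (σ := σ') h j t, σ, i, s => .mu h j (if σ = σ' ∧ j = i then t else t.subst i s)

/-! ### Denotational semantics -/

/-- An assignment of partial functionals to all variables. -/
def Env : Type := (σ : Ty) → ℕ → P σ

/-- The assignment that agrees with `ρ` except that `x_i^σ` is sent to `φ`. -/
def Env.update (ρ : Env) {σ : Ty} (i : ℕ) (φ : P σ) : Env := fun τ j =>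
  if e : σ = τ ∧ j = i then e.1 ▸ φ else ρ τ j

/-- The interpretation `[[t]]` of a term under an assignment. -/
noncomputable def Term.interp : {σ : Ty} → Term σ → Env → P σ
  | _, .zero, _ => (Part.some 0 : Part ℕ)
  | _, .suc, _ => fun k : ℕ => (Part.some (k + 1) : Part ℕ)
  | _, .pred, _ => fun k : ℕ => (Part.some (k - 1) : Part ℕ)
  | _, .case t₁ t₂ t₃, ρ => P.case (t₁.interp ρ) (t₂.interp ρ) (t₃.interp ρ)
  | σ, .var _ i, ρ => ρ σ i
  | _, .const _ φ, _ => φ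
  | _, .app t s, ρ => P.app (t.interp ρ) (s.interp ρ)
  | _, .lam _ i t, ρ => fun ξ => t.interp (ρ.update i ξ.toP)
  | _, .mu _ i t, ρ => P.lfp fun ψ => t.interp (ρ.update i ψ)

/-! ### Computation trees -/

/-- Lists `t₂, …, tₙ` of arguments that turn a term of type `σ` into one of type `0`. -/
inductive Args : Ty → Type
  | nil : Args .zero
  | cons {σ τ : Ty} (t : Term σ) (ts : Args τ) : Args (.arrow σ τ)

/-- The iterated application `t₁ t₂ ⋯ tₙ` of type `0`. -/
def Term.apps : {σ : Ty} → Term σ → Args σ → Term .zero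
  | _, t, .nil => t
  | _, t, .cons s ts => (Term.app t s).apps ts

/-- The term `t ξ₁ ⋯ ξₘ` of type `0`, for total `ξ₁, …, ξₘ` (as secondary constants). -/
def Term.applyTotal : {σ : Ty} → Term σ → Inputs σ → Term .zero
  | .zero, t, _ => t
  | .arrow _ _, t, ξs =>
    (Term.app t (.const (Ty.rank_dom t.rank_le) ξs.1.toP)).applyTotal ξs.2

/-- `TreeValue t n`: the computation tree of the closed term `t` of type `0` has the value `n`.
Values are assigned bottom-up. -/
inductive TreeValue : Term .zero → ℕ → Prop
  | zero : TreeValue .zero 0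
  | suc {t₁ : Term .zero} {a : ℕ} : TreeValue t₁ a → TreeValue (.app .suc t₁) (a + 1)
  | pred {t₁ : Term .zero} {a : ℕ} : TreeValue t₁ a → TreeValue (.app .pred t₁) (a - 1)
  | case_zero {t₁ t₂ t₃ : Term .zero} {n : ℕ} :
      TreeValue t₁ 0 → TreeValue t₂ n → TreeValue (.case t₁ t₂ t₃) n
  | case_succ {t₁ t₂ t₃ : Term .zero} {a n : ℕ} :
      TreeValue t₁ (a + 1) → TreeValue t₃ n → TreeValue (.case t₁ t₂ t₃) n
  /- A secondary constant of type `0` without arguments: its value is itself, if defined. -/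
  | const_zero (h : Ty.zero.rank ≤ 3) (k : ℕ) :
      TreeValue (.const h (Part.some k : Part ℕ)) k
  | const {σ τ : Ty} (h : (Ty.arrow σ τ).rank ≤ 3) (Φ : P (.arrow σ τ)) {t₂ : Term σ}
      {ts : Args τ} (Ψ : F σ) {n : ℕ} :
      (∀ ξs : Inputs σ, TreeValue (t₂.applyTotal ξs) (Ψ.eval ξs)) →
      TreeValue ((Term.const (Ty.rank_cod h) (Φ Ψ)).apps ts) n →
      TreeValue ((Term.const h Φ).apps (.cons t₂ ts)) n
  | lam {σ τ : Ty} (h : (Ty.arrow σ τ).rank ≤ 3) (i : ℕ) {t₁ : Term τ} {t₂ : Term σ}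
      {ts : Args τ} (Ψ : F σ) {n : ℕ} :
      (∀ ξs : Inputs σ, TreeValue (t₂.applyTotal ξs) (Ψ.eval ξs)) →
      TreeValue ((t₁.subst i t₂).apps ts) n →
      TreeValue ((Term.lam h i t₁).apps (.cons t₂ ts)) n
  | mu {σ : Ty} (h : σ.rank ≤ 3) (i : ℕ) {t₁ : Term σ} {ts : Args σ} {n : ℕ} :
      TreeValue ((t₁.subst i (.mu h i t₁)).apps ts) n →
      TreeValue ((Term.mu h i t₁).apps ts) n

/-- `Child t s`: the tree of `s` is one of the immediate subtrees of the tree of `t`. -/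
inductive Child : Term .zero → Term .zero → Prop
  | suc {t₁ : Term .zero} : Child (.app .suc t₁) t₁
  | pred {t₁ : Term .zero} : Child (.app .pred t₁) t₁
  | case_test {t₁ t₂ t₃ : Term .zero} : Child (.case t₁ t₂ t₃) t₁
  | case_zero {t₁ t₂ t₃ : Term .zero} : TreeValue t₁ 0 → Child (.case t₁ t₂ t₃) t₂
  | case_succ {t₁ t₂ t₃ : Term .zero} {a : ℕ} :
      TreeValue t₁ (a + 1) → Child (.case t₁ t₂ t₃) t₃
  | const_arg {σ τ : Ty} (h : (Ty.arrow σ τ).rank ≤ 3) (Φ : P (.arrow σ τ)) {t₂ : Term σ}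
      {ts : Args τ} (ξs : Inputs σ) :
      Child ((Term.const h Φ).apps (.cons t₂ ts)) (t₂.applyTotal ξs)
  | const_val {σ τ : Ty} (h : (Ty.arrow σ τ).rank ≤ 3) (Φ : P (.arrow σ τ)) {t₂ : Term σ}
      {ts : Args τ} (Ψ : F σ) :
      (∀ ξs : Inputs σ, TreeValue (t₂.applyTotal ξs) (Ψ.eval ξs)) →
      Child ((Term.const h Φ).apps (.cons t₂ ts))
        ((Term.const (Ty.rank_cod h) (Φ Ψ)).apps ts)
  | lam_arg {σ τ : Ty} (h : (Ty.arrow σ τ).rank ≤ 3) (i : ℕ) {t₁ : Term τ} {t₂ : Term σ}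
      {ts : Args τ} (ξs : Inputs σ) :
      Child ((Term.lam h i t₁).apps (.cons t₂ ts)) (t₂.applyTotal ξs)
  | lam_body {σ τ : Ty} (h : (Ty.arrow σ τ).rank ≤ 3) (i : ℕ) {t₁ : Term τ} {t₂ : Term σ}
      {ts : Args τ} (Ψ : F σ) :
      (∀ ξs : Inputs σ, TreeValue (t₂.applyTotal ξs) (Ψ.eval ξs)) →
      Child ((Term.lam h i t₁).apps (.cons t₂ ts)) ((t₁.subst i t₂).apps ts)
  | mu {σ : Ty} (h : σ.rank ≤ 3) (i : ℕ) {t₁ : Term σ} {ts : Args σ} :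
      Child ((Term.mu h i t₁).apps ts) ((t₁.subst i (.mu h i t₁)).apps ts)

/-- `InTree t l`: the finite sequence `l` of terms belongs to the computation tree of `t`. -/
inductive InTree : Term .zero → List (Term .zero) → Prop
  | root (t : Term .zero) : InTree t []
  | single (t : Term .zero) : InTree t [t]
  | step {t s : Term .zero} {l : List (Term .zero)} : Child t s → InTree s l → InTree t (t :: l)

/-- The computation tree `T[t]`, a set of finite sequences of terms. -/
def tree (t : Term .zero) : Set (List (Term .zero)) := {l | InTree t l}

/-- A tree of finite sequences is well-founded if it has no infinite branch. -/
def WellFoundedTree {α : Type} (T : Set (List α)) : Prop :=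
  ¬ ∃ f : ℕ → α, ∀ k : ℕ, (List.range k).map f ∈ T

/-! ### The least fixed points used in the interpretation exist -/

theorem P.undef_le : {σ : Ty} → (φ : P σ) → P.undef σ ≤ φ
  | .zero, φ => (bot_le : (⊥ : Part ℕ) ≤ φ)
  | .arrow _ _, φ => fun ξ => P.undef_le (φ ξ)

theorem F.eq_of_toP_le : {σ : Ty} → {ξ : F σ} → {φ : P σ} → ξ.toP ≤ φ → φ = ξ.toP
  | .zero, k, _, h => (Part.eq_some_iff.2 (h k (Part.mem_some _)) : _ = Part.some k)
  | .arrow _ _, _, _, h => funext fun a => F.eq_of_toP_le (h a)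

theorem F.toP_injective : {σ : Ty} → Function.Injective (F.toP (σ := σ))
  | .zero => fun _ _ h => Part.some_injective h
  | .arrow _ _ => fun _ _ h => funext fun a => F.toP_injective (congrFun h a)

theorem P.app_toP {σ τ : Ty} (u : P (.arrow σ τ)) (ξ : F σ) : P.app u ξ.toP = u ξ := by
  have h : ∃ ξ' : F σ, ξ'.toP = ξ.toP := ⟨ξ, rfl⟩
  rw [P.app, dif_pos h, F.toP_injective h.choose_spec]

theorem P.app_mono {σ τ : Ty} {u u' : P (.arrow σ τ)} {v v' : P σ} (hu : u ≤ u') (hv : v ≤ v') :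
    P.app u v ≤ P.app u' v' := by
  by_cases h : ∃ ξ : F σ, ξ.toP = v
  · obtain ⟨ξ, rfl⟩ := h
    rw [F.eq_of_toP_le hv, P.app_toP, P.app_toP]
    exact hu ξ
  · rw [P.app, dif_neg h]
    exact P.undef_le _

theorem P.case_mono {z z' x x' y y' : Part ℕ} (hz : z ≤ z') (hx : x ≤ x') (hy : y ≤ y') :
    P.case z x y ≤ P.case z' x' y' := by
  intro n hn
  obtain ⟨k, hk, hn⟩ := Part.mem_bind_iff.1 hn
  refine Part.mem_bind_iff.2 ⟨k, hz k hk, ?_⟩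
  split_ifs at hn ⊢
  · exact hx n hn
  · exact hy n hn

theorem P.exists_isLUB_of_isChain : (σ : Ty) → (c : Set (P σ)) → IsChain (· ≤ ·) c →
    ∃ b, IsLUB c b
  | .zero, c, hc => by
    by_cases h : ∃ x : Part ℕ, x ∈ c ∧ ∃ n, n ∈ x
    · obtain ⟨x, hx, n, hn⟩ := h
      refine ⟨x, fun y hy => ?_, fun y hy => hy hx⟩
      rcases hc.total hx hy with h | h
      · have hyn : (y : Part ℕ) = Part.some n := Part.eq_some_iff.2 (h n hn)
        have hxn : x = Part.some n := Part.eq_some_iff.2 hn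
        exact le_of_eq (hyn.trans hxn.symm)
      · exact h
    · refine ⟨P.undef _, fun y hy n hn => (h ⟨y, hy, n, hn⟩).elim, fun y _ => P.undef_le y⟩
  | .arrow σ τ, c, hc => by
    have key : ∀ ξ : F σ, ∃ b : P τ, IsLUB ((fun φ : P (.arrow σ τ) => φ ξ) '' c) b := fun ξ =>
      P.exists_isLUB_of_isChain τ _ <| by
        rintro _ ⟨φ, hφ, rfl⟩ _ ⟨ψ, hψ, rfl⟩ _
        exact (hc.total hφ hψ).imp (fun h => h ξ) (fun h => h ξ)
    choose b hb using key
    exact ⟨b, fun φ hφ ξ => (hb ξ).1 ⟨φ, hφ, rfl⟩, fun φ hφ ξ => (hb ξ).2 <| by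
      rintro _ ⟨ψ, hψ, rfl⟩
      exact hφ hψ ξ⟩

theorem P.exists_isLeast_fixedPoint {σ : Ty} {f : P σ → P σ} (hf : Monotone f) :
    ∃ ψ : P σ, IsLeast {ψ | f ψ = ψ} ψ := by
  obtain ⟨m, hm⟩ := zorn_le₀ {x : P σ | x ≤ f x ∧ ∀ y, f y = y → x ≤ y} <| by
    intro c hcs hc
    obtain ⟨b, hb⟩ := P.exists_isLUB_of_isChain σ c hc
    exact ⟨b, ⟨hb.2 fun x hx => (hcs hx).1.trans (hf (hb.1 hx)),
      fun y hy => hb.2 fun x hx => (hcs hx).2 y hy⟩, fun x hx => hb.1 hx⟩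
  have hfm : f m ≤ m :=
    hm.2 ⟨hf hm.1.1, fun y hy => (hf (hm.1.2 y hy)).trans (le_of_eq hy)⟩ hm.1.1
  exact ⟨m, le_antisymm hfm hm.1.1, fun y hy => hm.1.2 y hy⟩

theorem P.isLeast_lfp {σ : Ty} {f : P σ → P σ} (hf : Monotone f) :
    IsLeast {ψ | f ψ = ψ} (P.lfp f) := by
  have h := P.exists_isLeast_fixedPoint hf
  rw [P.lfp, dif_pos h]
  exact h.choose_spec

theorem P.lfp_mono {σ : Ty} {f g : P σ → P σ} (hf : Monotone f) (hg : Monotone g)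
    (h : ∀ ψ, f ψ ≤ g ψ) : P.lfp f ≤ P.lfp g := by
  obtain ⟨m, hm⟩ := zorn_le₀ {x : P σ | x ≤ f x ∧ x ≤ P.lfp f ∧ x ≤ P.lfp g} <| by
    intro c hcs hc
    obtain ⟨b, hb⟩ := P.exists_isLUB_of_isChain σ c hc
    exact ⟨b, ⟨hb.2 fun x hx => (hcs hx).1.trans (hf (hb.1 hx)),
      hb.2 fun x hx => (hcs hx).2.1, hb.2 fun x hx => (hcs hx).2.2⟩, fun x hx => hb.1 hx⟩
  have hfm : f m ≤ m := hm.2 ⟨hf hm.1.1, (hf hm.1.2.1).trans (le_of_eq (P.isLeast_lfp hf).1),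
    ((hf hm.1.2.2).trans (h _)).trans (le_of_eq (P.isLeast_lfp hg).1)⟩ hm.1.1
  exact ((P.isLeast_lfp hf).2 (le_antisymm hfm hm.1.1)).trans hm.1.2.2

theorem Env.update_mono {ρ ρ' : Env} (hρ : ∀ τ j, ρ τ j ≤ ρ' τ j) {σ : Ty} (i : ℕ) {φ φ' : P σ}
    (hφ : φ ≤ φ') (τ : Ty) (j : ℕ) : ρ.update i φ τ j ≤ ρ'.update i φ' τ j := by
  unfold Env.update
  split_ifs with e
  · obtain ⟨rfl, rfl⟩ := e
    exact hφ
  · exact hρ τ j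

theorem Term.interp_mono {σ : Ty} (t : Term σ) : ∀ {ρ ρ' : Env}, (∀ τ j, ρ τ j ≤ ρ' τ j) →
    t.interp ρ ≤ t.interp ρ' := by
  induction t with
  | zero => exact fun _ => le_rfl
  | suc => exact fun _ => le_rfl
  | pred => exact fun _ => le_rfl
  | case t₁ t₂ t₃ ih₁ ih₂ ih₃ =>
    exact fun h => P.case_mono (ih₁ h) (ih₂ h) (ih₃ h)
  | var _ i => exact fun h => h _ i
  | const => exact fun _ => le_rfl
  | app t s iht ihs => exact fun h => P.app_mono (iht h) (ihs h)
  | lam _ i t ih => exact fun h ξ => ih (Env.update_mono h i le_rfl)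
  | mu _ i t ih =>
    intro ρ ρ' h
    exact P.lfp_mono (fun _ _ hψ => ih (Env.update_mono (fun _ _ => le_rfl) i hψ))
      (fun _ _ hψ => ih (Env.update_mono (fun _ _ => le_rfl) i hψ))
      (fun ψ => ih (Env.update_mono h i le_rfl))

/-- `[[μ x t]]` is the least fixed point of `ψ ↦ [[t]](x := ψ)`. -/
theorem Term.isLeast_interp_mu {σ : Ty} (h : σ.rank ≤ 3) (i : ℕ) (t : Term σ) (ρ : Env) :
    IsLeast {ψ | t.interp (ρ.update i ψ) = ψ} ((Term.mu h i t).interp ρ) :=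
  P.isLeast_lfp fun _ _ hψ => t.interp_mono (Env.update_mono (fun _ _ => le_rfl) i hψ)

end PartialLambda

namespace PartialLambda

/-! ### Free variables, closed terms and substitution -/

/-! Soundness (`TreeValue.interp_eq`) is an induction on the tree value: each rule preserves the
denotation of a closed term. For β-steps this is the substitution lemma `Term.interp_subst`, and for
μ-steps only the fixed point equation is used. The values of an argument on all total inputs
determine its denotation (`Term.interp_eq_toP`), so the argument is indeed total.

Since values are unique by soundness, the subtrees of a term with a value are exactly those visited
by the derivation of that value. Hence the same induction shows that the child relation is
accessible below the term (`TreeValue.acc`), which excludes infinite branches.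

Adequacy, the converse, uses the logical relation `Realizes`. Every term realizes its own
interpretation, once its variables are replaced by closed terms realizing their assigned values
(`Term.realizes_psubst`). The relation is stable under head expansion (`Realizes.of_treeValue`),
which handles λ and μ. The functionals realized by a fixed term are closed under suprema
(`Realizes.of_isLUB`), so induction up to the least fixed point is possible (`Realizes.lfp`). At
type `0`, realizing a number means having it as tree value. -/

theorem Env.update_self (ρ : Env) {σ : Ty} (i : ℕ) (φ : P σ) : ρ.update i φ σ i = φ := by
  simp [Env.update]

theorem Env.update_of_ne (ρ : Env) {σ τ : Ty} {i j : ℕ} (φ : P σ) (h : ¬ (σ = τ ∧ j = i)) :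
    ρ.update i φ τ j = ρ τ j := by
  simp only [Env.update, dif_neg h]

theorem Env.update_update (ρ : Env) {σ : Ty} (i : ℕ) (φ ψ : P σ) :
    (ρ.update i φ).update i ψ = ρ.update i ψ := by
  funext τ j
  unfold Env.update
  split_ifs <;> rfl

theorem Env.update_comm (ρ : Env) {σ τ : Ty} {i j : ℕ} (φ : P σ) (ψ : P τ)
    (h : ¬ (σ = τ ∧ j = i)) :
    (ρ.update i φ).update j ψ = (ρ.update j ψ).update i φ := by
  funext υ k
  unfold Env.update
  split_ifs with h₁ h₂ h₂
  · exact (h ⟨h₂.1.trans h₁.1.symm, h₁.2.symm.trans h₂.2⟩).elim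
  · rfl
  · rfl
  · rfl

/-- The interpretation depends only on the values of the free variables. -/
theorem Term.interp_congr {τ : Ty} (t : Term τ) : ∀ {ρ ρ' : Env},
    (∀ σ i, t.FreeIn σ i → ρ σ i = ρ' σ i) → t.interp ρ = t.interp ρ' := by
  have upd : ∀ {υ σ : Ty} (t : Term υ) (j : ℕ) (φ : P σ) (ρ ρ' : Env),
      (∀ σ' i, (¬ (σ = σ' ∧ j = i) ∧ t.FreeIn σ' i) → ρ σ' i = ρ' σ' i) →
      ∀ σ' i, t.FreeIn σ' i → ρ.update j φ σ' i = ρ'.update j φ σ' i := by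
    intro υ σ t j φ ρ ρ' h σ' i hi
    unfold Env.update
    split_ifs with e
    · rfl
    · exact h σ' i ⟨fun e' => e ⟨e'.1, e'.2.symm⟩, hi⟩
  induction t with
  | zero => intros; rfl
  | suc => intros; rfl
  | pred => intros; rfl
  | case t₁ t₂ t₃ ih₁ ih₂ ih₃ =>
    intro ρ ρ' h
    simp only [Term.interp]
    rw [ih₁ fun σ i hi => h σ i (Or.inl hi), ih₂ fun σ i hi => h σ i (Or.inr (Or.inl hi)),
      ih₃ fun σ i hi => h σ i (Or.inr (Or.inr hi))]
  | var _ i => exact fun h => h _ i ⟨rfl, rfl⟩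
  | const => intros; rfl
  | app t s iht ihs =>
    intro ρ ρ' h
    simp only [Term.interp]
    rw [iht fun σ i hi => h σ i (Or.inl hi), ihs fun σ i hi => h σ i (Or.inr hi)]
  | lam _ j t ih =>
    intro ρ ρ' h
    exact funext fun ξ => ih (upd t j ξ.toP ρ ρ' h)
  | mu _ j t ih =>
    intro ρ ρ' h
    exact congrArg P.lfp (funext fun ψ => ih (upd t j ψ ρ ρ' h))

theorem Term.Closed.interp_eq {τ : Ty} {t : Term τ} (ht : t.Closed) (ρ ρ' : Env) :
    t.interp ρ = t.interp ρ' :=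
  t.interp_congr fun σ i hi => (ht σ i hi).elim

/-- Closedness of `s` excludes capture and makes its interpretation independent of the values given
to bound variables, so the update for `i` can be moved past each binder. -/
theorem Term.interp_subst {τ σ : Ty} (t : Term τ) (i : ℕ) {s : Term σ} (hs : s.Closed) :
    ∀ ρ : Env, (t.subst i s).interp ρ = t.interp (ρ.update i (s.interp ρ)) := by
  have key : ∀ {υ : Ty} (ρ : Env) (j : ℕ) (φ : P υ), ¬ (σ = υ ∧ j = i) →
      (ρ.update j φ).update i (s.interp (ρ.update j φ)) =
        (ρ.update i (s.interp ρ)).update j φ := by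
    intro υ ρ j φ h
    rw [hs.interp_eq (ρ.update j φ) ρ, Env.update_comm _ _ _ h]
  induction t with
  | zero => intro; rfl
  | suc => intro; rfl
  | pred => intro; rfl
  | case t₁ t₂ t₃ ih₁ ih₂ ih₃ =>
    intro ρ
    simp only [Term.subst, Term.interp, ih₁, ih₂, ih₃]
    rfl
  | var h j =>
    intro ρ
    simp only [Term.subst, Term.interp]
    split_ifs with e
    · obtain ⟨rfl, rfl⟩ := e
      rw [Env.update_self]
    · rw [Env.update_of_ne _ _ e, Term.interp]
  | const => intro; rfl
  | app t u iht ihu =>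
    intro ρ
    simp only [Term.subst, Term.interp, iht, ihu]
  | lam h j t ih =>
    intro ρ
    simp only [Term.subst, Term.interp]
    funext ξ
    split_ifs with e
    · obtain ⟨rfl, rfl⟩ := e
      rw [Env.update_update]
    · rw [ih, key ρ j _ e]
  | mu h j t ih =>
    intro ρ
    simp only [Term.subst, Term.interp]
    congr 1
    funext ψ
    split_ifs with e
    · obtain ⟨rfl, rfl⟩ := e
      rw [Env.update_update]
    · rw [ih, key ρ j _ e]

theorem Term.freeIn_of_subst {τ σ : Ty} (t : Term τ) (i : ℕ) {s : Term σ} (hs : s.Closed)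
    {σ' : Ty} {j : ℕ} : (t.subst i s).FreeIn σ' j → t.FreeIn σ' j ∧ ¬ (σ = σ' ∧ i = j) := by
  induction t with
  | zero => exact False.elim
  | suc => exact False.elim
  | pred => exact False.elim
  | case t₁ t₂ t₃ ih₁ ih₂ ih₃ =>
    rintro (h | h | h)
    · exact ⟨Or.inl (ih₁ h).1, (ih₁ h).2⟩
    · exact ⟨Or.inr (Or.inl (ih₂ h).1), (ih₂ h).2⟩
    · exact ⟨Or.inr (Or.inr (ih₃ h).1), (ih₃ h).2⟩
  | var h k =>
    simp only [Term.subst]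
    split_ifs with e
    · obtain ⟨rfl, rfl⟩ := e
      exact fun h => (hs _ _ h).elim
    · rintro ⟨rfl, rfl⟩
      exact ⟨⟨rfl, rfl⟩, fun e' => e ⟨e'.1, e'.2.symm⟩⟩
  | const => exact False.elim
  | app t u iht ihu =>
    rintro (h | h)
    · exact ⟨Or.inl (iht h).1, (iht h).2⟩
    · exact ⟨Or.inr (ihu h).1, (ihu h).2⟩
  | lam h k t ih =>
    simp only [Term.subst, Term.FreeIn]
    split_ifs with e
    · obtain ⟨rfl, rfl⟩ := e
      exact fun h => ⟨h, h.1⟩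
    · exact fun h => ⟨⟨h.1, (ih h.2).1⟩, (ih h.2).2⟩
  | mu h k t ih =>
    simp only [Term.subst, Term.FreeIn]
    split_ifs with e
    · obtain ⟨rfl, rfl⟩ := e
      exact fun h => ⟨h, h.1⟩
    · exact fun h => ⟨⟨h.1, (ih h.2).1⟩, (ih h.2).2⟩

theorem Term.subst_of_not_freeIn {τ σ : Ty} (t : Term τ) (i : ℕ) (s : Term σ) :
    ¬ t.FreeIn σ i → t.subst i s = t := by
  induction t with
  | zero => intro; rfl
  | suc => intro; rfl
  | pred => intro; rfl
  | case t₁ t₂ t₃ ih₁ ih₂ ih₃ =>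
    intro h
    simp only [Term.FreeIn, not_or] at h
    simp only [Term.subst, ih₁ h.1, ih₂ h.2.1, ih₃ h.2.2]
  | var h j =>
    intro h
    simp only [Term.subst]
    rw [dif_neg fun e => h ⟨e.1.symm, e.2⟩]
  | const => intro; rfl
  | app t u iht ihu =>
    intro h
    simp only [Term.FreeIn, not_or] at h
    simp only [Term.subst, iht h.1, ihu h.2]
  | lam h j t ih =>
    intro h
    simp only [Term.subst]
    split_ifs with e
    · rfl
    · rw [ih fun h' => h ⟨fun e' => e ⟨e'.1.symm, e'.2⟩, h'⟩]
  | mu h j t ih =>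
    intro h
    simp only [Term.subst]
    split_ifs with e
    · rfl
    · rw [ih fun h' => h ⟨fun e' => e ⟨e'.1.symm, e'.2⟩, h'⟩]

theorem Term.closed_const {σ : Ty} (h : σ.rank ≤ 3) (φ : P σ) : (Term.const h φ).Closed :=
  fun _ _ => id

theorem Term.closed_app {σ τ : Ty} {t : Term (.arrow σ τ)} {s : Term σ} :
    (Term.app t s).Closed ↔ t.Closed ∧ s.Closed :=
  ⟨fun h => ⟨fun σ i hi => h σ i (Or.inl hi), fun σ i hi => h σ i (Or.inr hi)⟩,
    fun h σ i hi => hi.elim (h.1 σ i) (h.2 σ i)⟩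

theorem Term.closed_case {t₁ t₂ t₃ : Term .zero} :
    (Term.case t₁ t₂ t₃).Closed ↔ t₁.Closed ∧ t₂.Closed ∧ t₃.Closed :=
  ⟨fun h => ⟨fun σ i hi => h σ i (Or.inl hi), fun σ i hi => h σ i (Or.inr (Or.inl hi)),
    fun σ i hi => h σ i (Or.inr (Or.inr hi))⟩,
    fun h σ i hi => hi.elim (h.1 σ i) fun hi => hi.elim (h.2.1 σ i) (h.2.2 σ i)⟩

theorem Term.Closed.subst_lam {σ τ : Ty} {h : (Ty.arrow σ τ).rank ≤ 3} {i : ℕ} {t : Term τ}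
    (ht : (Term.lam h i t).Closed) {s : Term σ} (hs : s.Closed) : (t.subst i s).Closed := by
  intro σ' j hj
  obtain ⟨h₁, h₂⟩ := t.freeIn_of_subst i hs hj
  exact ht σ' j ⟨h₂, h₁⟩

theorem Term.Closed.subst_mu {σ : Ty} {h : σ.rank ≤ 3} {i : ℕ} {t : Term σ}
    (ht : (Term.mu h i t).Closed) {s : Term σ} (hs : s.Closed) : (t.subst i s).Closed := by
  intro σ' j hj
  obtain ⟨h₁, h₂⟩ := t.freeIn_of_subst i hs hj
  exact ht σ' j ⟨h₂, h₁⟩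

theorem Term.Closed.of_apps {σ : Ty} {t : Term σ} {ts : Args σ} (h : (t.apps ts).Closed) :
    t.Closed := by
  induction ts with
  | nil => exact h
  | cons s ts ih => exact (Term.closed_app.1 (ih h)).1

/-- A tree step changes the head and keeps the remaining arguments; this carries closedness along
such a step. -/
theorem Term.Closed.apps_congr {σ : Ty} {t s : Term σ} {ts : Args σ} (h : (t.apps ts).Closed)
    (hs : s.Closed) : (s.apps ts).Closed := by
  induction ts with
  | nil => exact hs
  | cons a ts ih =>
    exact ih h (Term.closed_app.2 ⟨hs, (Term.closed_app.1 (Term.Closed.of_apps h)).2⟩)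

theorem Term.Closed.applyTotal : {σ : Ty} → {t : Term σ} → t.Closed → (ξs : Inputs σ) →
    (t.applyTotal ξs).Closed
  | .zero, _, ht, _ => ht
  | .arrow _ _, _, ht, ξs =>
    Term.Closed.applyTotal (Term.closed_app.2 ⟨ht, Term.closed_const _ _⟩) ξs.2

/-! ### Soundness -/

theorem Term.interp_apps_congr {σ : Ty} {t s : Term σ} (ts : Args σ) {ρ : Env}
    (h : t.interp ρ = s.interp ρ) : (t.apps ts).interp ρ = (s.apps ts).interp ρ := by
  induction ts with
  | nil => exact h
  | cons a ts ih =>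
    refine ih ?_
    simp only [Term.interp, h]

/-- Links the tree's test of an argument on all total inputs with the totality that `P.app` demands.
Secondary constants denote themselves, so each one supplied evaluates the interpretation at that
point. -/
theorem Term.interp_eq_toP {σ : Ty} {t : Term σ} {Ψ : F σ} {ρ : Env}
    (h : ∀ ξs : Inputs σ,
      (t.applyTotal ξs).interp ρ = (Part.some (Ψ.eval ξs) : Part ℕ)) :
    t.interp ρ = Ψ.toP := by
  induction σ with
  | zero => exact h ()
  | arrow σ τ _ ih =>
    funext ξ
    have := ih (t := t.app (.const (Ty.rank_dom t.rank_le) ξ.toP)) (Ψ := Ψ ξ)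
      fun ξs => h (ξ, ξs)
    simp only [Term.interp, P.app_toP] at this
    exact this

theorem Term.interp_mu_eq {σ : Ty} {h : σ.rank ≤ 3} {i : ℕ} {t : Term σ}
    (ht : (Term.mu h i t).Closed) (ρ : Env) :
    (Term.mu h i t).interp ρ = (t.subst i (.mu h i t)).interp ρ := by
  rw [Term.interp_subst t i ht]
  exact (Term.isLeast_interp_mu h i t ρ).1.symm

theorem TreeValue.interp_eq {t : Term .zero} {n : ℕ} (h : TreeValue t n) (ht : t.Closed)
    (ρ : Env) : t.interp ρ = (Part.some n : Part ℕ) := by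
  induction h with
  | zero => rfl
  | @suc t₁ a _ ih =>
    rw [Term.interp, ih (Term.closed_app.1 ht).2]
    exact P.app_toP (σ := .zero) (τ := .zero) _ a
  | @pred t₁ a _ ih =>
    rw [Term.interp, ih (Term.closed_app.1 ht).2]
    exact P.app_toP (σ := .zero) (τ := .zero) _ a
  | case_zero _ _ ih₁ ih₂ =>
    obtain ⟨h₁, h₂, -⟩ := Term.closed_case.1 ht
    rw [Term.interp, ih₁ h₁, ih₂ h₂]
    simp only [P.case, Part.bind_some]
    rfl
  | case_succ _ _ ih₁ ih₂ =>
    obtain ⟨h₁, -, h₂⟩ := Term.closed_case.1 ht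
    rw [Term.interp, ih₁ h₁, ih₂ h₂]
    simp only [P.case, Part.bind_some]
    rfl
  | const_zero => rfl
  | @const σ τ h Φ t₂ ts Ψ n _ _ ih₁ ih₂ =>
    have h₂ := (Term.closed_app.1 (Term.Closed.of_apps (t := (Term.const h Φ).app t₂) ht)).2
    rw [← ih₂ (Term.Closed.apps_congr (t := (Term.const h Φ).app t₂) ht (Term.closed_const _ _))]
    refine Term.interp_apps_congr ts ?_
    change P.app Φ (t₂.interp ρ) = Φ Ψ
    rw [Term.interp_eq_toP fun ξs => ih₁ ξs (h₂.applyTotal ξs), P.app_toP]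
  | @lam σ τ h i t₁ t₂ ts Ψ n _ _ ih₁ ih₂ =>
    obtain ⟨h₁, h₂⟩ := Term.closed_app.1
      (Term.Closed.of_apps (t := (Term.lam h i t₁).app t₂) ht)
    rw [← ih₂ (Term.Closed.apps_congr (t := (Term.lam h i t₁).app t₂) ht (h₁.subst_lam h₂))]
    refine Term.interp_apps_congr ts ?_
    rw [Term.interp, Term.interp_subst _ _ h₂,
      Term.interp_eq_toP fun ξs => ih₁ ξs (h₂.applyTotal ξs), P.app_toP]
    rfl
  | @mu σ h i t₁ ts n _ ih =>
    have h₁ := Term.Closed.of_apps ht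
    rw [← ih (Term.Closed.apps_congr ht (h₁.subst_mu h₁))]
    exact Term.interp_apps_congr ts (Term.interp_mu_eq h₁ ρ)

/-- By soundness, both values equal the denotation under one arbitrary assignment. -/
theorem TreeValue.unique {t : Term .zero} {m n : ℕ} (hm : TreeValue t m) (hn : TreeValue t n)
    (ht : t.Closed) : m = n :=
  Part.some_injective ((hm.interp_eq ht fun σ _ => P.undef σ).symm.trans (hn.interp_eq ht _))

theorem F.ext_eval {σ : Ty} {f g : F σ} (h : ∀ ξs, f.eval ξs = g.eval ξs) : f = g := by
  induction σ with
  | zero => exact h ()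
  | arrow σ τ _ ih => exact funext fun ξ => ih fun ξs => h (ξ, ξs)

/-! ### Well-foundedness -/

/-- The head of an iterated application, together with its arguments. -/
def Term.spine : {σ : Ty} → Term σ → Args σ → (τ : Ty) × Term τ × Args τ
  | _, .app t s, ts => t.spine (.cons s ts)
  | σ, t, ts => ⟨σ, t, ts⟩

/-- `apps` is a recursive function, so equations between iterated applications cannot be split by
injectivity of constructors. Comparing spines reduces them to equations between heads and argument
lists; the inversion lemmas for `Child` rest on this. -/
theorem Term.spine_apps {σ : Ty} (t : Term σ) (ts : Args σ) :
    (t.apps ts).spine .nil = t.spine ts := by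
  induction ts with
  | nil => rfl
  | cons s ts ih => exact (ih _).trans (by simp only [Term.spine])

theorem Child.of_apps_const {σ τ : Ty} {h : (Ty.arrow σ τ).rank ≤ 3} {Φ : P (.arrow σ τ)}
    {t₂ : Term σ} {ts : Args τ} {c : Term .zero}
    (hc : Child ((Term.const h Φ).apps (.cons t₂ ts)) c) :
    (∃ ξs, c = t₂.applyTotal ξs) ∨ ∃ Ψ : F σ,
      (∀ ξs, TreeValue (t₂.applyTotal ξs) (Ψ.eval ξs)) ∧
        c = (Term.const (Ty.rank_cod h) (Φ Ψ)).apps ts := by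
  generalize e : (Term.const h Φ).apps (.cons t₂ ts) = t at hc
  have e := congrArg (fun t : Term .zero => t.spine .nil) e
  cases hc <;> simp only [Term.spine_apps, Term.spine] at e <;> cases e
  case const_arg ξs _ => exact Or.inl ⟨ξs, rfl⟩
  case const_val Ψ _ hΨ => exact Or.inr ⟨Ψ, hΨ, rfl⟩

theorem Child.of_apps_lam {σ τ : Ty} {h : (Ty.arrow σ τ).rank ≤ 3} {i : ℕ} {t₁ : Term τ}
    {t₂ : Term σ} {ts : Args τ} {c : Term .zero}
    (hc : Child ((Term.lam h i t₁).apps (.cons t₂ ts)) c) :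
    (∃ ξs, c = t₂.applyTotal ξs) ∨ c = (t₁.subst i t₂).apps ts := by
  generalize e : (Term.lam h i t₁).apps (.cons t₂ ts) = t at hc
  have e := congrArg (fun t : Term .zero => t.spine .nil) e
  cases hc <;> simp only [Term.spine_apps, Term.spine] at e <;> cases e
  case lam_arg ξs _ => exact Or.inl ⟨ξs, rfl⟩
  case lam_body => exact Or.inr rfl

theorem Child.of_apps_mu {σ : Ty} {h : σ.rank ≤ 3} {i : ℕ} {t₁ : Term σ} {ts : Args σ}
    {c : Term .zero} (hc : Child ((Term.mu h i t₁).apps ts) c) :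
    c = (t₁.subst i (.mu h i t₁)).apps ts := by
  generalize e : (Term.mu h i t₁).apps ts = t at hc
  have e := congrArg (fun t : Term .zero => t.spine .nil) e
  cases hc <;> simp only [Term.spine_apps, Term.spine] at e <;> cases e
  rfl

theorem Child.of_suc {t c : Term .zero} (hc : Child (.app .suc t) c) : c = t := by
  generalize e : Term.app .suc t = u at hc
  have e := congrArg (fun t : Term .zero => t.spine .nil) e
  cases hc <;> simp only [Term.spine_apps, Term.spine] at e <;> cases e
  rfl

theorem Child.of_pred {t c : Term .zero} (hc : Child (.app .pred t) c) : c = t := by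
  generalize e : Term.app .pred t = u at hc
  have e := congrArg (fun t : Term .zero => t.spine .nil) e
  cases hc <;> simp only [Term.spine_apps, Term.spine] at e <;> cases e
  rfl

theorem Child.of_case {t₁ t₂ t₃ c : Term .zero} (hc : Child (.case t₁ t₂ t₃) c) :
    c = t₁ ∨ (TreeValue t₁ 0 ∧ c = t₂) ∨ ∃ a, TreeValue t₁ (a + 1) ∧ c = t₃ := by
  generalize e : Term.case t₁ t₂ t₃ = u at hc
  have e := congrArg (fun t : Term .zero => t.spine .nil) e
  cases hc <;> simp only [Term.spine_apps, Term.spine] at e <;> cases e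
  case case_test => exact Or.inl rfl
  case case_zero h => exact Or.inr (Or.inl ⟨h, rfl⟩)
  case case_succ a h => exact Or.inr (Or.inr ⟨a, h, rfl⟩)

theorem Child.not_zero {c : Term .zero} : ¬ Child .zero c := by
  intro hc
  generalize e : Term.zero = u at hc
  have e := congrArg (fun t : Term .zero => t.spine .nil) e
  cases hc <;> simp only [Term.spine_apps, Term.spine] at e <;> cases e

theorem Child.not_const {h : Ty.zero.rank ≤ 3} {φ : P .zero} {c : Term .zero} :
    ¬ Child (.const h φ) c := by
  intro hc
  generalize e : Term.const h φ = u at hc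
  have e := congrArg (fun t : Term .zero => t.spine .nil) e
  cases hc <;> simp only [Term.spine_apps, Term.spine] at e <;> cases e

/-- A computation tree with a value has no infinite branch: `Child` is well-founded below `t`. -/
theorem TreeValue.acc {t : Term .zero} {n : ℕ} (h : TreeValue t n) (ht : t.Closed) :
    Acc (fun s t => Child t s) t := by
  induction h with
  | zero => exact ⟨_, fun c hc => (Child.not_zero hc).elim⟩
  | suc _ ih =>
    refine ⟨_, fun c hc => ?_⟩
    rw [hc.of_suc]
    exact ih (Term.closed_app.1 ht).2
  | pred _ ih =>
    refine ⟨_, fun c hc => ?_⟩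
    rw [hc.of_pred]
    exact ih (Term.closed_app.1 ht).2
  | case_zero h₁ _ ih₁ ih₂ =>
    obtain ⟨ht₁, ht₂, -⟩ := Term.closed_case.1 ht
    refine ⟨_, fun c hc => ?_⟩
    obtain rfl | ⟨-, rfl⟩ | ⟨a, ha, -⟩ := hc.of_case
    · exact ih₁ ht₁
    · exact ih₂ ht₂
    -- The other branch is a subtree only if the test also has a positive value, against uniqueness.
    · exact (Nat.succ_ne_zero a (ha.unique h₁ ht₁)).elim
  | case_succ h₁ _ ih₁ ih₂ =>
    obtain ⟨ht₁, -, ht₃⟩ := Term.closed_case.1 ht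
    refine ⟨_, fun c hc => ?_⟩
    obtain rfl | ⟨h₀, -⟩ | ⟨-, -, rfl⟩ := hc.of_case
    · exact ih₁ ht₁
    · exact (Nat.succ_ne_zero _ (h₁.unique h₀ ht₁)).elim
    · exact ih₂ ht₃
  | const_zero => exact ⟨_, fun c hc => (Child.not_const hc).elim⟩
  | @const σ τ h Φ t₂ ts Ψ n h₁ _ ih₁ ih₂ =>
    have ht₂ := (Term.closed_app.1 (Term.Closed.of_apps (t := (Term.const h Φ).app t₂) ht)).2
    refine ⟨_, fun c hc => ?_⟩
    obtain ⟨ξs, rfl⟩ | ⟨Ψ', hΨ', rfl⟩ := hc.of_apps_const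
    · exact ih₁ ξs (ht₂.applyTotal ξs)
    -- The functional tabulated by the child is the one in the derivation, because tree values are
    -- unique; only then does the induction hypothesis apply.
    · obtain rfl : Ψ = Ψ' := F.ext_eval fun ξs => (h₁ ξs).unique (hΨ' ξs) (ht₂.applyTotal ξs)
      exact ih₂ (Term.Closed.apps_congr (t := (Term.const h Φ).app t₂) ht (Term.closed_const _ _))
  | @lam σ τ h i t₁ t₂ ts Ψ n _ _ ih₁ ih₂ =>
    obtain ⟨ht₁, ht₂⟩ := Term.closed_app.1
      (Term.Closed.of_apps (t := (Term.lam h i t₁).app t₂) ht)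
    refine ⟨_, fun c hc => ?_⟩
    obtain ⟨ξs, rfl⟩ | rfl := hc.of_apps_lam
    · exact ih₁ ξs (ht₂.applyTotal ξs)
    · exact ih₂ (Term.Closed.apps_congr (t := (Term.lam h i t₁).app t₂) ht (ht₁.subst_lam ht₂))
  | mu h i _ ih =>
    have h₁ := Term.Closed.of_apps ht
    refine ⟨_, fun c hc => ?_⟩
    rw [hc.of_apps_mu]
    exact ih (Term.Closed.apps_congr ht (h₁.subst_mu h₁))

theorem InTree.head_eq {t a : Term .zero} {l : List (Term .zero)} (h : InTree t (a :: l)) :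
    a = t := by
  cases h <;> rfl

theorem InTree.child {t a b : Term .zero} {l : List (Term .zero)} (h : InTree t (a :: b :: l)) :
    Child t b ∧ InTree b (b :: l) := by
  cases h with
  | step hc hl =>
    obtain rfl := hl.head_eq
    exact ⟨hc, hl⟩

/-- The tail of an infinite branch is an infinite branch in the tree of its first term, which is a
child of `t`. -/
theorem wellFoundedTree_of_acc {t : Term .zero} (h : Acc (fun s t => Child t s) t) :
    WellFoundedTree (tree t) := by
  induction h with
  | intro t _ ih =>
    rintro ⟨f, hf⟩
    have hc : ∀ k, Child t (f 1) ∧ InTree (f 1) ((List.range (k + 1)).map fun j => f (j + 1)) := by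
      intro k
      -- Two entries are needed to see a child: `f 0` is the root `t`, and the rest of the prefix
      -- starts at `f 1`.
      have := hf (k + 2)
      rw [List.range_succ_eq_map, List.range_succ_eq_map] at this
      have := InTree.child this
      rw [List.range_succ_eq_map]
      simpa [Function.comp_def] using this
    refine ih (f 1) (hc 0).1 ⟨fun j => f (j + 1), fun k => ?_⟩
    cases k with
    | zero => exact InTree.root _
    | succ k => exact (hc k).2

/-! ### Parallel substitution -/

/-- A simultaneous substitution of terms for all variables. -/
def Substitution : Type := (σ : Ty) → σ.rank ≤ 3 → ℕ → Term σ

/-- The substitution that agrees with `γ` except that `x_i^σ` is replaced by `s`. -/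
def Substitution.update (γ : Substitution) {σ : Ty} (i : ℕ) (s : Term σ) : Substitution :=
  fun τ h j => if e : σ = τ ∧ j = i then e.1 ▸ s else γ τ h j

/-- Simultaneous substitution for all free variables; variable capture is not avoided. -/
def Term.psubst : {τ : Ty} → Term τ → Substitution → Term τ
  | _, .zero, _ => .zero
  | _, .suc, _ => .suc
  | _, .pred, _ => .pred
  | _, .case t₁ t₂ t₃, γ => .case (t₁.psubst γ) (t₂.psubst γ) (t₃.psubst γ)
  | _, .var h j, γ => γ _ h j
  | _, .const h φ, _ => .const h φ
  | _, .app t u, γ => .app (t.psubst γ) (u.psubst γ)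
  | _, .lam (σ := σ) h j t, γ =>
    .lam h j (t.psubst (γ.update j (.var (Ty.rank_dom h : σ.rank ≤ 3) j)))
  | _, .mu h j t, γ => .mu h j (t.psubst (γ.update j (.var h j)))

theorem Substitution.update_self (γ : Substitution) {σ : Ty} (h : σ.rank ≤ 3) (i : ℕ)
    (s : Term σ) : γ.update i s σ h i = s := by
  simp [Substitution.update]

theorem Substitution.update_of_ne (γ : Substitution) {σ τ : Ty} (h : τ.rank ≤ 3) {i j : ℕ}
    (s : Term σ) (e : ¬ (σ = τ ∧ j = i)) : γ.update i s τ h j = γ τ h j := by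
  simp only [Substitution.update, dif_neg e]

theorem Substitution.update_update (γ : Substitution) {σ : Ty} (i : ℕ) (s u : Term σ) :
    (γ.update i s).update i u = γ.update i u := by
  funext τ _ j
  unfold Substitution.update
  split_ifs <;> rfl

theorem Substitution.update_comm (γ : Substitution) {σ τ : Ty} {i j : ℕ} (s : Term σ)
    (u : Term τ) (h : ¬ (σ = τ ∧ j = i)) :
    (γ.update i s).update j u = (γ.update j u).update i s := by
  funext υ _ k
  unfold Substitution.update
  split_ifs with h₁ h₂ h₂
  · exact (h ⟨h₂.1.trans h₁.1.symm, h₁.2.symm.trans h₂.2⟩).elim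
  · rfl
  · rfl
  · rfl

/-- Every variable is replaced by a closed term or by itself. -/
def Substitution.ClosedOrVar (γ : Substitution) : Prop :=
  ∀ (σ : Ty) (h : σ.rank ≤ 3) (j : ℕ), (γ σ h j).Closed ∨ γ σ h j = .var h j

theorem Substitution.ClosedOrVar.update_var {γ : Substitution} (hγ : γ.ClosedOrVar) {σ : Ty}
    (h : σ.rank ≤ 3) (i : ℕ) : (γ.update i (.var h i)).ClosedOrVar := by
  intro τ h' j
  by_cases e : σ = τ ∧ j = i
  · obtain ⟨rfl, rfl⟩ := e
    exact Or.inr (γ.update_self h j _)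
  · rw [γ.update_of_ne h' _ e]
    exact hγ τ h' j

/-- Performing a β- or μ-step after a simultaneous substitution amounts to extending that
substitution. `ClosedOrVar` ensures that replacing `x_i^σ` does not touch the terms already
inserted, and it survives passing under a binder, where the bound variable is sent to itself. -/
theorem Term.subst_psubst {τ σ : Ty} (t : Term τ) (h : σ.rank ≤ 3) (i : ℕ) (s : Term σ) :
    ∀ {γ : Substitution}, γ.ClosedOrVar →
      (t.psubst (γ.update i (.var h i))).subst i s = t.psubst (γ.update i s) := by
  induction t with
  | zero => intros; rfl
  | suc => intros; rfl
  | pred => intros; rfl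
  | case t₁ t₂ t₃ ih₁ ih₂ ih₃ =>
    intro γ hγ
    simp only [Term.psubst, Term.subst, ih₁ hγ, ih₂ hγ, ih₃ hγ]
  | @var υ h' j =>
    intro γ hγ
    simp only [Term.psubst]
    by_cases e : σ = υ ∧ j = i
    · obtain ⟨rfl, rfl⟩ := e
      simp [Substitution.update_self, Term.subst]
    · rw [γ.update_of_ne h' _ e, γ.update_of_ne h' _ e]
      refine Term.subst_of_not_freeIn _ _ _ fun hf => ?_
      rcases hγ υ h' j with hc | hv
      · exact hc _ _ hf
      · rw [hv] at hf
        exact e ⟨hf.1.symm, hf.2⟩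
  | const => intros; rfl
  | app t u iht ihu =>
    intro γ hγ
    simp only [Term.psubst, Term.subst, iht hγ, ihu hγ]
  | @lam υ τ h' j t ih =>
    intro γ hγ
    simp only [Term.psubst, Term.subst]
    congr 1
    split_ifs with e
    · obtain ⟨rfl, rfl⟩ := e
      rw [Substitution.update_update, Substitution.update_update]
    · rw [Substitution.update_comm _ _ _ e, ih (hγ.update_var _ j),
        Substitution.update_comm _ _ _ e]
  | @mu υ h' j t ih =>
    intro γ hγ
    simp only [Term.psubst, Term.subst]
    congr 1
    split_ifs with e
    · obtain ⟨rfl, rfl⟩ := e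
      rw [Substitution.update_update, Substitution.update_update]
    · rw [Substitution.update_comm _ _ _ e, ih (hγ.update_var _ j),
        Substitution.update_comm _ _ _ e]

theorem Substitution.update_var_eq {γ : Substitution} {σ : Ty} (h : σ.rank ≤ 3) {j : ℕ}
    {p : (τ : Ty) → ℕ → Prop}
    (hγ : ∀ τ (h' : τ.rank ≤ 3) i, ¬ (σ = τ ∧ j = i) ∧ p τ i → γ τ h' i = .var h' i)
    (τ : Ty) (h' : τ.rank ≤ 3) (i : ℕ) (hp : p τ i) :
    γ.update j (.var h j) τ h' i = .var h' i := by
  by_cases e : σ = τ ∧ i = j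
  · obtain ⟨rfl, rfl⟩ := e
    exact γ.update_self h i _
  · rw [γ.update_of_ne h' _ e]
    exact hγ τ h' i ⟨fun e' => e ⟨e'.1, e'.2.symm⟩, hp⟩

theorem Term.psubst_eq_self {τ : Ty} (t : Term τ) : ∀ {γ : Substitution},
    (∀ σ (h : σ.rank ≤ 3) i, t.FreeIn σ i → γ σ h i = .var h i) → t.psubst γ = t := by
  induction t with
  | zero => intros; rfl
  | suc => intros; rfl
  | pred => intros; rfl
  | case t₁ t₂ t₃ ih₁ ih₂ ih₃ =>
    intro γ hγ
    rw [Term.psubst, ih₁ fun σ h i hi => hγ σ h i (Or.inl hi),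
      ih₂ fun σ h i hi => hγ σ h i (Or.inr (Or.inl hi)),
      ih₃ fun σ h i hi => hγ σ h i (Or.inr (Or.inr hi))]
  | var h j => exact fun hγ => hγ _ h j ⟨rfl, rfl⟩
  | const => intros; rfl
  | app t u iht ihu =>
    intro γ hγ
    rw [Term.psubst, iht fun σ h i hi => hγ σ h i (Or.inl hi),
      ihu fun σ h i hi => hγ σ h i (Or.inr hi)]
  | lam h j t ih =>
    intro γ hγ
    rw [Term.psubst, ih (Substitution.update_var_eq (Ty.rank_dom h) hγ)]
  | mu h j t ih =>
    intro γ hγ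
    rw [Term.psubst, ih (Substitution.update_var_eq h hγ)]

theorem Substitution.update_var_not_freeIn {γ : Substitution} {σ : Ty} (h : σ.rank ≤ 3) {j : ℕ}
    {υ : Ty} {k : ℕ} (hγ : ∀ τ (h' : τ.rank ≤ 3) i, ¬ (γ τ h' i).FreeIn υ k)
    (e : ¬ (σ = υ ∧ j = k)) (τ : Ty) (h' : τ.rank ≤ 3) (i : ℕ) :
    ¬ (γ.update j (.var h j) τ h' i).FreeIn υ k := by
  by_cases e' : σ = τ ∧ i = j
  · obtain ⟨rfl, rfl⟩ := e'
    rw [γ.update_self]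
    exact e
  · rw [γ.update_of_ne h' _ e']
    exact hγ τ h' i

/-- Under a binder the substitution acquires the bound variable as a free one, but the binder
captures it again. -/
theorem Term.not_freeIn_psubst {τ : Ty} (t : Term τ) {υ : Ty} {k : ℕ} : ∀ {γ : Substitution},
    (∀ σ (h : σ.rank ≤ 3) i, ¬ (γ σ h i).FreeIn υ k) → ¬ (t.psubst γ).FreeIn υ k := by
  induction t with
  | zero => exact fun _ => id
  | suc => exact fun _ => id
  | pred => exact fun _ => id
  | case t₁ t₂ t₃ ih₁ ih₂ ih₃ =>
    exact fun hγ h => h.elim (ih₁ hγ) fun h => h.elim (ih₂ hγ) (ih₃ hγ)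
  | var h j => exact fun hγ => hγ _ h j
  | const => exact fun _ => id
  | app t u iht ihu => exact fun hγ h => h.elim (iht hγ) (ihu hγ)
  | lam h j t ih =>
    exact fun hγ h' => ih (Substitution.update_var_not_freeIn (Ty.rank_dom h) hγ h'.1) h'.2
  | mu h j t ih =>
    exact fun hγ h' => ih (Substitution.update_var_not_freeIn h hγ h'.1) h'.2

/-! ### Adequacy -/

/-- The logical relation between partial functionals and closed terms: the term computes at least
the functional, on all arguments that compute total functionals. -/
def Realizes : {σ : Ty} → Term σ → P σ → Prop
  | .zero, t, φ => ∀ n : ℕ, φ = (Part.some n : Part ℕ) → TreeValue t n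
  | .arrow σ _, t, φ =>
    ∀ (ξ : F σ) (s : Term σ), s.Closed → Realizes s ξ.toP → Realizes (t.app s) (φ ξ)

/-- Head expansion: unfolding the relation through all arguments leaves only tree values of full
applications. -/
theorem Realizes.of_treeValue {σ : Ty} {t s : Term σ} {φ : P σ} (h : Realizes t φ)
    (hts : ∀ (ts : Args σ) (n : ℕ), TreeValue (t.apps ts) n → TreeValue (s.apps ts) n) :
    Realizes s φ := by
  induction σ with
  | zero => exact fun n hn => hts .nil n (h n hn)
  | arrow σ τ _ ih =>
    exact fun ξ u hu hξ => ih (h ξ u hu hξ) fun ts n => hts (.cons u ts) n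

theorem realizes_undef {σ : Ty} (t : Term σ) : Realizes t (P.undef σ) := by
  induction σ with
  | zero => exact fun n hn => (Part.some_ne_none n hn.symm).elim
  | arrow σ τ _ ih => exact fun ξ s _ _ => ih _

/-- The two claims need each other. Testing a term on total inputs applies it to constants, which
must realize themselves; and a constant applied to an argument has a value only once that argument
has been tabulated on all total inputs. -/
theorem Realizes.treeValue_and_const : (σ : Ty) →
    (∀ (t : Term σ) (ξ : F σ), Realizes t ξ.toP →
      ∀ ξs : Inputs σ, TreeValue (t.applyTotal ξs) (ξ.eval ξs)) ∧
    ∀ (h : σ.rank ≤ 3) (φ : P σ), Realizes (.const h φ) φ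
  | .zero => by
    refine ⟨fun t ξ h _ => h ξ rfl, fun h φ n hn => ?_⟩
    subst hn
    exact .const_zero h n
  | .arrow σ τ => by
    obtain ⟨hσ₁, hσ₂⟩ := Realizes.treeValue_and_const σ
    obtain ⟨hτ₁, hτ₂⟩ := Realizes.treeValue_and_const τ
    refine ⟨fun t ξ h ξs => hτ₁ _ _ (h ξs.1 _ (Term.closed_const _ _) (hσ₂ _ _)) ξs.2, ?_⟩
    intro h φ ξ s _ hξ
    exact (hτ₂ (Ty.rank_cod h) (φ ξ)).of_treeValue fun ts n hn =>
      .const h φ ξ (hσ₁ s ξ hξ) hn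

theorem Realizes.treeValue {σ : Ty} {t : Term σ} {ξ : F σ} (h : Realizes t ξ.toP)
    (ξs : Inputs σ) : TreeValue (t.applyTotal ξs) (ξ.eval ξs) :=
  (Realizes.treeValue_and_const σ).1 t ξ h ξs

theorem realizes_const {σ : Ty} (h : σ.rank ≤ 3) (φ : P σ) : Realizes (.const h φ) φ :=
  (Realizes.treeValue_and_const σ).2 h φ

/-- At type `0`, a defined supremum is attained by a member of `c`. At higher types, suprema are
computed pointwise. -/
theorem Realizes.of_isLUB {σ : Ty} {t : Term σ} {c : Set (P σ)} {b : P σ} (hb : IsLUB c b)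
    (hc : ∀ φ ∈ c, Realizes t φ) : Realizes t b := by
  induction σ with
  | zero =>
    intro n hn
    by_contra hv
    have : b ≤ (Part.none : Part ℕ) := hb.2 fun φ hφ => by
      intro m hm
      have hbm : b = (Part.some m : Part ℕ) := Part.eq_some_iff.2 (hb.1 hφ m hm)
      obtain rfl : n = m := Part.some_injective (hn.symm.trans hbm)
      exact (hv (hc φ hφ n (Part.eq_some_iff.2 hm))).elim
    exact Part.notMem_none n (this n (Part.eq_some_iff.1 hn))
  | arrow σ τ _ ih =>
    intro ξ s hs hξ
    refine ih (c := (fun φ : P (.arrow σ τ) => φ ξ) '' c) ⟨?_, ?_⟩ ?_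
    · rintro _ ⟨φ, hφ, rfl⟩
      exact hb.1 hφ ξ
    · classical
      intro χ hχ
      -- Lowering `b` to `χ` at the single point `ξ` still gives an upper bound of `c`, so `b ξ ≤
      -- χ`.
      let w : F σ → P τ := fun η => if η = ξ then χ else b η
      have : b ≤ (w : P (.arrow σ τ)) := by
        refine hb.2 fun φ hφ η => ?_
        by_cases e : η = ξ
        · have hw : w η = χ := if_pos e
          subst e
          exact (hχ ⟨φ, hφ, rfl⟩).trans_eq hw.symm
        · have hw : w η = b η := if_neg e
          exact (hb.1 hφ η).trans_eq hw.symm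
      exact (this ξ).trans_eq (if_pos rfl)
    · rintro _ ⟨φ, hφ, rfl⟩
      exact hc φ hφ ξ s hs hξ

/-- Zorn's lemma replaces transfinite iteration. Among the realized `x ≤ f x` below the least fixed
point, a maximal `m` satisfies `f m = m`, because `f m` is again of this kind; leastness then gives
`m = P.lfp f`. -/
theorem Realizes.lfp {σ : Ty} {t : Term σ} {f : P σ → P σ} (hf : Monotone f)
    (h : ∀ ψ, Realizes t ψ → Realizes t (f ψ)) : Realizes t (P.lfp f) := by
  obtain ⟨m, hm⟩ := zorn_le₀ {x : P σ | x ≤ f x ∧ x ≤ P.lfp f ∧ Realizes t x} <| by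
    intro c hcs hc
    obtain ⟨b, hb⟩ := P.exists_isLUB_of_isChain σ c hc
    exact ⟨b, ⟨hb.2 fun x hx => (hcs hx).1.trans (hf (hb.1 hx)),
      hb.2 fun x hx => (hcs hx).2.1, .of_isLUB hb fun x hx => (hcs hx).2.2⟩,
      fun x hx => hb.1 hx⟩
  have hfm : f m ≤ m := hm.2 ⟨hf hm.1.1, (hf hm.1.2.1).trans (le_of_eq (P.isLeast_lfp hf).1),
    h m hm.1.2.2⟩ hm.1.1
  have : P.lfp f = m :=
    le_antisymm ((P.isLeast_lfp hf).2 (le_antisymm hfm hm.1.1)) hm.1.2.1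
  rw [this]
  exact hm.1.2.2

/-- Every variable is replaced by a closed term that realizes its assigned value. -/
def Substitution.Realizes (γ : Substitution) (ρ : Env) : Prop :=
  ∀ (σ : Ty) (h : σ.rank ≤ 3) (i : ℕ), (γ σ h i).Closed ∧ PartialLambda.Realizes (γ σ h i) (ρ σ i)

theorem Substitution.Realizes.update {γ : Substitution} {ρ : Env} (hγ : γ.Realizes ρ) {σ : Ty}
    (i : ℕ) {s : Term σ} {φ : P σ} (hs : s.Closed) (hφ : PartialLambda.Realizes s φ) :
    (γ.update i s).Realizes (ρ.update i φ) := by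
  intro τ h j
  by_cases e : σ = τ ∧ j = i
  · obtain ⟨rfl, rfl⟩ := e
    rw [γ.update_self, ρ.update_self]
    exact ⟨hs, hφ⟩
  · rw [γ.update_of_ne h _ e, ρ.update_of_ne _ e]
    exact hγ τ h j

theorem Substitution.Realizes.closedOrVar {γ : Substitution} {ρ : Env} (hγ : γ.Realizes ρ) :
    γ.ClosedOrVar :=
  fun σ h j => Or.inl (hγ σ h j).1

theorem Substitution.Realizes.closed_psubst {γ : Substitution} {ρ : Env} (hγ : γ.Realizes ρ)
    {τ : Ty} (t : Term τ) : (t.psubst γ).Closed :=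
  fun _ _ => t.not_freeIn_psubst fun σ h i => (hγ σ h i).1 _ _

/-- The fundamental lemma of the logical relation. The substitution and the assignment must vary
together in the induction, since λ and μ extend both. -/
theorem Term.realizes_psubst {τ : Ty} (t : Term τ) : ∀ {γ : Substitution} {ρ : Env},
    γ.Realizes ρ → Realizes (t.psubst γ) (t.interp ρ) := by
  induction t with
  | zero =>
    intro γ ρ hγ n hn
    obtain rfl : 0 = n := Part.some_injective hn
    exact .zero
  | suc =>
    intro γ ρ hγ k s hs hk n hn
    obtain rfl : Nat.succ k = n := Part.some_injective hn
    exact .suc (hk k rfl)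
  | pred =>
    intro γ ρ hγ k s hs hk n hn
    obtain rfl : Nat.pred k = n := Part.some_injective hn
    exact .pred (hk k rfl)
  | case t₁ t₂ t₃ ih₁ ih₂ ih₃ =>
    intro γ ρ hγ n hn
    have hn : n ∈ P.case (t₁.interp ρ) (t₂.interp ρ) (t₃.interp ρ) := Part.eq_some_iff.1 hn
    obtain ⟨k, hk, hn⟩ := Part.mem_bind_iff.1 hn
    have h₁ := ih₁ hγ k (Part.eq_some_iff.2 hk)
    cases k with
    | zero => exact .case_zero h₁ (ih₂ hγ n (Part.eq_some_iff.2 hn))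
    | succ k => exact .case_succ h₁ (ih₃ hγ n (Part.eq_some_iff.2 hn))
  | var h i => exact fun hγ => (hγ _ h i).2
  | const h φ => exact fun _ => realizes_const h φ
  | app t s iht ihs =>
    intro γ ρ hγ
    simp only [Term.interp]
    by_cases h : ∃ ξ : F _, ξ.toP = s.interp ρ
    · obtain ⟨ξ, hξ⟩ := h
      have hs := ihs hγ
      rw [← hξ] at hs ⊢
      rw [P.app_toP]
      exact iht hγ ξ _ (hγ.closed_psubst s) hs
    -- A non-total argument makes the application everywhere undefined, and any term realizes that.
    · rw [P.app, dif_neg h]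
      exact realizes_undef _
  | lam h i t ih =>
    intro γ ρ hγ ξ s hs hξ
    refine (ih (hγ.update i hs hξ)).of_treeValue fun ts n hn => ?_
    rw [← t.subst_psubst (Ty.rank_dom h) i s hγ.closedOrVar] at hn
    -- The λ-rule also evaluates its argument; since `s` realizes a total functional, all these
    -- subtrees have values.
    exact .lam h i ξ hξ.treeValue hn
  | mu h i t ih =>
    intro γ ρ hγ
    have hc := hγ.closed_psubst (Term.mu h i t)
    refine Realizes.lfp
      (fun _ _ hψ => t.interp_mono (Env.update_mono (fun _ _ => le_rfl) i hψ)) fun ψ hψ => ?_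
    -- If the μ-term realizes `ψ`, its unfolding realizes the next iterate, and one μ-step transfers
    -- this back to the μ-term.
    refine (ih (hγ.update i hc hψ)).of_treeValue fun ts n hn => ?_
    rw [← t.subst_psubst h i _ hγ.closedOrVar] at hn
    exact .mu h i hn

theorem Term.Closed.treeValue {t : Term .zero} (ht : t.Closed) {ρ : Env} {n : ℕ}
    (h : t.interp ρ = (Part.some n : Part ℕ)) : TreeValue t n := by
  -- Secondary constants supply closed realizers for every assigned value; on the closed term `t`
  -- this substitution acts as the identity.
  let γ : Substitution := fun σ hσ i => .const hσ (ρ σ i)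
  have hγ : γ.Realizes ρ :=
    fun σ hσ i => ⟨Term.closed_const _ _, realizes_const _ _⟩
  have := t.realizes_psubst hγ n h
  rwa [t.psubst_eq_self fun σ _ i hi => (ht σ i hi).elim] at this

end PartialLambda

theorem mainTheorem6 (t : PartialLambda.Term PartialLambda.Ty.zero) (ht : t.Closed)
    (ρ : PartialLambda.Env) (n : ℕ) :
    t.interp ρ = (Part.some n : Part ℕ) ↔
      PartialLambda.WellFoundedTree (PartialLambda.tree t) ∧ PartialLambda.TreeValue t n :=
  ⟨fun h => ⟨PartialLambda.wellFoundedTree_of_acc ((ht.treeValue h).acc ht), ht.treeValue h⟩,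
    fun h => h.2.interp_eq ht ρ⟩
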